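/- A matching on $[2n]=\{1,2,\ldots,2n\}$ is a partition of $[2n]$ in which every block contains exactly two elements. Its canonical sequential form is the sequence $\pi_1\pi_2\cdots\pi_{2n}$ in which, when the blocks are numbered $1,2,\ldots,n$ in increasing order of their smallest elements, $\pi_x$ is the number of the block containing $x$. A matching contains the pattern $\tau=\tau_1\tau_2\cdots\tau_k$ if its canonical sequential form has a subsequence $\pi_{x_1}\pi_{x_2}\cdots\pi_{x_k}$ with $x_1<x_2<\cdots<x_k$ that is order-isomorphic to $\tau$, i.e. for all $1\le i,j\le k$ one has $\pi_{x_i}<\pi_{x_j}$ if and only if $\tau_i<\tau_j$; otherwise it avoids $\tau$. **Theorem.** For every integer $n\ge 0$, the number of matchings on $[2n]$ that avoid the pattern $12312$ equals the $3$-Catalan number $$C_{n,3}=\frac{1}{2n+1}\binom{3n}{n}.$$ -/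

import Mathlib

/-- A matching on `[2n] = {1, …, 2n}`: a partition of `[2n]` in which every block contains
exactly two elements. -/
def Matching (n : ℕ) : Type :=
  {P : Finpartition (Finset.Icc 1 (2 * n)) // ∀ B ∈ P.parts, B.card = 2}

/-- The canonical sequential form of a matching on `[2n]`, a sequence of length `2n`.
The blocks are labelled `1, 2, …, n` in the increasing order of their initial points (minima);
each point of `[2n]` carries the label of the block that contains it, that is, the number of
blocks whose initial point is at most that of its own block.
The position `x : Fin (2 * n)` is counted from `0`, so it stands for the point `x + 1`. -/
def Matching.canonicalForm {n : ℕ} (M : Matching n) (x : Fin (2 * n)) : ℕ :=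
  (M.1.parts.filter fun B => B.min ≤ (M.1.part (x.1 + 1)).min).card

/-- Two sequences of the same length are order-isomorphic. -/
def OrderIsomorphic {k : ℕ} (π τ : Fin k → ℕ) : Prop :=
  ∀ i j : Fin k, π i < π j ↔ τ i < τ j

/-- The matching `M` contains the pattern `τ`: some subsequence of its canonical sequential form
(entries at positions `f 0 < f 1 < ⋯ < f (k - 1)`) is order-isomorphic to `τ`. -/
def Matching.Contains {n k : ℕ} (M : Matching n) (τ : Fin k → ℕ) : Prop :=
  ∃ f : Fin k → Fin (2 * n), StrictMono f ∧ OrderIsomorphic (fun i => M.canonicalForm (f i)) τ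

/-- The matching `M` avoids the pattern `τ`. -/
def Matching.Avoids {n k : ℕ} (M : Matching n) (τ : Fin k → ℕ) : Prop :=
  ¬ M.Contains τ

/-- There are only finitely many matchings on `[2n]`. -/
instance Matching.instFinite (n : ℕ) : Finite (Matching n) :=
  inferInstanceAs
    (Finite {P : Finpartition (Finset.Icc 1 (2 * n)) // ∀ B ∈ P.parts, B.card = 2})

/-- The `k`-Catalan number `C_{n,k} = 1 / ((k - 1) n + 1) * binom (k n) n`. -/
def kCatalan (n k : ℕ) : ℚ :=
  1 / (((k : ℚ) - 1) * n + 1) * ((k * n).choose n : ℚ)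

/-!
The canonical sequential form identifies matchings on `[2n]` with the words in which each of the
labels `1, …, n` occurs twice and the first occurrences are increasing
(`Matching.canonicalForm_injective`, `Matching.exists_canonicalForm_eq`). Deleting both copies of
the largest label `n + 1` from such a word leaves a word of the same kind with labels `1, …, n`.
Conversely, every entry behind the first copy of `n + 1` is the second occurrence of its label, so
a word that avoids `12312` is obtained from one with labels `1, …, n` exactly by inserting `n + 1`
twice into a strictly decreasing suffix: two smaller entries `a ≤ b` in this order behind the first
`n + 1` would either be a third occurrence of a label or complete the pattern `a b (n + 1) a b`.

Words are stored reversed, so that decreasing suffixes become increasing prefixes. If `s` is the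
length of the longest increasing prefix, the insertions correspond to the pairs `j ≤ h ≤ s`, and the
new word has the longest increasing prefix of length `j + 1`. This succession rule, starting at
`s = 0`, produces exactly `[x ^ (n - s)] T ^ (2 s)` words with parameter `s`, where `T = 1 + x T ^ 3`
(`sum_avoidingWords`): each of the two nested summations over `h` and `j` is a summation by parts
with `T ^ (q + 1) = ∑ i, x ^ i T ^ (q + 2 i)`, and so raises the exponent of `T` by one. Summing
over `s` by the same identity gives `[x ^ n] T`, which is the `3`-Catalan number.
-/

/-! ### The Fuss–Catalan recursion -/

/-- The coefficient of `x ^ k` in `T ^ r`, where `T = 1 + x T ^ 3` is the generating function of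
ternary trees, computed by the recursion that `T ^ (r + 1) = T ^ r + x T ^ (r + 3)` gives. -/
def ternaryCoeff : ℕ → ℕ → ℕ
  | 0, _ => 1
  | _ + 1, 0 => 0
  | k + 1, r + 1 => ternaryCoeff (k + 1) r + ternaryCoeff k (r + 3)

lemma ternaryCoeff_zero_left (r : ℕ) : ternaryCoeff 0 r = 1 := by
  rw [ternaryCoeff]

/-- A ballot-type closed form, which satisfies the recursion by Pascal's rule. -/
lemma ternaryCoeff_add_two_mul_choose (k r : ℕ) :
    ternaryCoeff (k + 1) r + 2 * (3 * k + r + 2).choose k = (3 * k + r + 2).choose (k + 1) := by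
  induction k generalizing r with
  | zero =>
    induction r with
    | zero => simp [ternaryCoeff]
    | succ r ih =>
      rw [ternaryCoeff, ternaryCoeff_zero_left]
      simp at ih ⊢
      omega
  | succ k ihk =>
    induction r with
    | zero =>
      have h := Nat.choose_succ_right_eq (3 * (k + 1) + 0 + 2) (k + 1)
      rw [show 3 * (k + 1) + 0 + 2 - (k + 1) = 2 * (k + 1 + 1) by omega, ← mul_assoc] at h
      have h' := Nat.eq_of_mul_eq_mul_right (Nat.succ_pos _) h
      rw [ternaryCoeff, h']
      ring
    | succ r ih =>
      have h := ihk (r + 3)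
      rw [show 3 * k + (r + 3) + 2 = 3 * (k + 1) + r + 2 by ring] at h
      rw [ternaryCoeff, show 3 * (k + 1) + (r + 1) + 2 = 3 * (k + 1) + r + 2 + 1 by ring,
        Nat.choose_succ_succ' _ (k + 1), Nat.choose_succ_succ' _ k]
      omega

lemma two_mul_add_one_mul_ternaryCoeff_one (n : ℕ) :
    (2 * n + 1) * ternaryCoeff n 1 = (3 * n).choose n := by
  cases n with
  | zero => simp [ternaryCoeff]
  | succ k =>
    have h := ternaryCoeff_add_two_mul_choose k 1
    have h' := Nat.choose_succ_right_eq (3 * k + 1 + 2) k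
    rw [show 3 * k + 1 + 2 - k = 2 * k + 3 by omega] at h'
    rw [show 3 * (k + 1) = 3 * k + 1 + 2 by ring]
    generalize (3 * k + 1 + 2).choose (k + 1) = c at *
    generalize (3 * k + 1 + 2).choose k = d at *
    nlinarith

/-- The identity `T ^ (q + 1) = ∑ i, x ^ i T ^ (q + 2 i)`, coefficient by coefficient. -/
lemma sum_ternaryCoeff (k q : ℕ) :
    ∑ i ∈ Finset.range (k + 1), ternaryCoeff (k - i) (q + 2 * i) = ternaryCoeff k (q + 1) := by
  induction k generalizing q with
  | zero => simp [ternaryCoeff]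
  | succ k ih =>
    rw [Finset.sum_range_succ', ternaryCoeff, ← ih (q + 2), add_comm]
    congr 1
    refine Finset.sum_congr rfl fun i _ => ?_
    rw [show k + 1 - (i + 1) = k - i by omega, show q + 2 * (i + 1) = q + 2 + 2 * i by ring]

/-- Summation by parts against the coefficients of the powers of `T`. -/
lemma sum_ternaryCoeff_mul_sum (n r : ℕ) (f : ℕ → ℕ) :
    ∑ s ∈ Finset.range (n + 1), ternaryCoeff (n - s) (2 * s + r) *
        ∑ h ∈ Finset.range (s + 1), f h =
      ∑ h ∈ Finset.range (n + 1), ternaryCoeff (n - h) (2 * h + r + 1) * f h := by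
  simp_rw [Finset.mul_sum]
  rw [Finset.sum_comm' (t' := Finset.range (n + 1)) (s' := fun h => Finset.Ico h (n + 1))
    (by intro s h; simp; omega)]
  refine Finset.sum_congr rfl fun h hh => ?_
  have hh : h ≤ n := by simpa [Nat.lt_succ_iff] using hh
  rw [← Finset.sum_mul, Finset.sum_Ico_eq_sum_range, ← sum_ternaryCoeff,
    show n + 1 - h = n - h + 1 by omega]
  congr 1
  refine Finset.sum_congr rfl fun i _ => ?_
  rw [show n - (h + i) = n - h - i by omega, show 2 * (h + i) + r = 2 * h + r + 2 * i by ring]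

/-! ### Words -/

/-- `w` is the reverse of a word in which each of the labels `1, …, n` occurs twice and, for
`1 ≤ k < n`, every occurrence of `k + 1` comes after some occurrence of `k`. Reversing puts the
changes made by adding a new largest label at the head of the list. -/
structure IsReversedCanonical (n : ℕ) (w : List ℕ) : Prop where
  count_eq : ∀ a, w.count a = if 1 ≤ a ∧ a ≤ n then 2 else 0
  mem_of_succ : ∀ s t k, w = s ++ (k + 1) :: t → 1 ≤ k → k ∈ t

open List in
/-- The reverse of the word `w` avoids the pattern `12312`. -/
def AvoidsReversed (w : List ℕ) : Prop :=
  ∀ a b c, a < b → b < c → ¬ [b, a, c, b, a] <+ w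

namespace IsReversedCanonical

variable {n : ℕ} {w : List ℕ}

lemma le_of_mem (hw : IsReversedCanonical n w) {a : ℕ} (ha : a ∈ w) : a ≤ n := by
  have h := List.count_pos_iff.2 ha
  rw [hw.count_eq] at h
  split_ifs at h with h' <;> omega

lemma succ_notMem (hw : IsReversedCanonical n w) : n + 1 ∉ w := fun h => by
  have := hw.le_of_mem h
  omega

/-- A suffix that contains a label contains all smaller labels. -/
lemma mem_of_le (hw : IsReversedCanonical n w) {s t : List ℕ} (hst : w = s ++ t) {k i : ℕ}
    (hk : k ∈ t) (hi : 1 ≤ i) (hik : i ≤ k) : i ∈ t := by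
  induction k with
  | zero => omega
  | succ k ih =>
    rcases hik.eq_or_lt with rfl | h
    · exact hk
    · obtain ⟨t₁, t₂, rfl⟩ := List.append_of_mem hk
      have := hw.mem_of_succ (s ++ t₁) t₂ k (by simp [hst]) (by omega)
      exact ih (by simp [this]) (by omega)

lemma pair_sublist (hw : IsReversedCanonical n w) {s t : List ℕ} (hst : w = s ++ t) {a b : ℕ}
    (hb : b ∈ t) (ha : 1 ≤ a) (hab : a < b) : [b, a].Sublist t := by
  obtain ⟨t₁, t₂, rfl⟩ := List.append_of_mem hb
  obtain ⟨k, rfl⟩ : ∃ k, b = k + 1 := ⟨b - 1, by omega⟩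
  have := hw.mem_of_succ (s ++ t₁) t₂ k (by simp [hst]) (by omega)
  have : a ∈ t₂ := hw.mem_of_le (s := s ++ t₁ ++ [k + 1]) (by simp [hst]) this ha (by omega)
  exact ((List.singleton_sublist.2 this).cons_cons (k + 1)).trans (List.sublist_append_right _ _)

end IsReversedCanonical

/-! ### Adding a largest label -/

lemma filter_ne_eq_self {m : ℕ} {l : List ℕ} (h : m ∉ l) : l.filter (· ≠ m) = l :=
  List.filter_eq_self.2 fun a ha => by simpa using fun h' : a = m => h (h' ▸ ha)

lemma filter_ne_insert_pair {m : ℕ} {p q r : List ℕ} (hp : m ∉ p) (hq : m ∉ q) (hr : m ∉ r) :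
    (p ++ m :: (q ++ m :: r)).filter (· ≠ m) = p ++ (q ++ r) := by
  have h1 := filter_ne_eq_self hp
  have h2 := filter_ne_eq_self hq
  have h3 := filter_ne_eq_self hr
  simp only [List.filter_append, List.filter_cons, h1, h2, h3]
  simp

open List in
/-- Adding the label `n + 1` so that the entries before its last occurrence increase keeps the
word canonical, and creates no pattern: in a new pattern `n + 1` plays the largest letter, so the
two letters in front of it would decrease. -/
lemma IsReversedCanonical.insert_pair {n : ℕ} {p q r : List ℕ}
    (hw : IsReversedCanonical n (p ++ (q ++ r))) (hav : AvoidsReversed (p ++ (q ++ r)))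
    (hs : (p ++ q).Pairwise (· < ·)) :
    IsReversedCanonical (n + 1) (p ++ (n + 1) :: (q ++ (n + 1) :: r)) ∧
      AvoidsReversed (p ++ (n + 1) :: (q ++ (n + 1) :: r)) := by
  have hm := hw.succ_notMem
  simp only [mem_append, not_or] at hm
  obtain ⟨hmp, hmq, hmr⟩ := hm
  have hf := filter_ne_insert_pair hmp hmq hmr
  have hcount : ∀ a, (p ++ (n + 1) :: (q ++ (n + 1) :: r)).count a =
      if 1 ≤ a ∧ a ≤ n + 1 then 2 else 0 := by
    intro a
    have h := hw.count_eq a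
    simp only [count_append, count_cons, beq_iff_eq] at h ⊢
    split_ifs at h ⊢ <;> omega
  refine ⟨⟨hcount, ?_⟩, ?_⟩
  · intro s t k hst hk
    by_cases hkn : k = n
    · subst hkn
      -- The label `k` cannot occur twice in the increasing list `p ++ q`.
      have hkr : k ∈ r := by
        by_contra hkr
        have h1 := hw.count_eq k
        have h2 := (nodup_iff_count_le_one.1 (hs.imp (fun h => h.ne))) k
        rw [← append_assoc, count_append, count_eq_zero_of_not_mem hkr] at h1
        simp [hk] at h1
        simp at h2
        omega
      -- The suffix `r` lies behind both copies of `k + 1`, so it is part of `t`.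
      have hr : r <:+ (k + 1) :: t := by
        have h1 : (k + 1) :: t <:+ p ++ (k + 1) :: (q ++ (k + 1) :: r) := ⟨s, hst.symm⟩
        have h2 : r <:+ p ++ (k + 1) :: (q ++ (k + 1) :: r) :=
          ⟨p ++ (k + 1) :: (q ++ [k + 1]), by simp⟩
        rcases suffix_or_suffix_of_suffix h1 h2 with h | h
        · exact absurd (h.subset (by simp)) hmr
        · exact h
      rcases suffix_cons_iff.1 hr with h | h
      · exact absurd (by simp [h]) hmr
      · exact h.subset hkr
    · rw [hst] at hf
      have h1 : k + 1 ≠ n + 1 := by omega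
      rw [filter_append, filter_cons_of_pos (by simpa using hkn)] at hf
      have := hw.mem_of_succ _ _ k hf.symm hk
      exact (mem_filter.1 this).1
  · intro a b c hab hbc hsub
    have hc : c ≤ n + 1 := by
      have h := count_pos_iff.2 (hsub.subset (show c ∈ [b, a, c, b, a] by simp))
      rw [hcount] at h
      split_ifs at h <;> omega
    rcases hc.lt_or_eq with hc | rfl
    · have h := hsub.filter (· ≠ n + 1)
      rw [hf, filter_ne_eq_self (by simp; omega)] at h
      exact hav a b c hab hbc h
    · obtain ⟨r₁, r₂, hr, h1, h2⟩ := append_sublist_iff.1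
        (show [b, a] ++ [n + 1, b, a] <+ _ from hsub)
      have hm2 : n + 1 ∈ r₂ := h2.subset (by simp)
      -- Otherwise `r₁` contains both copies of `n + 1`, and a third one remains for `r₂`.
      have key : r₁ <+: p ++ (n + 1) :: q := by
        have h3 : p ++ (n + 1) :: (q ++ (n + 1) :: r) =
            (p ++ (n + 1) :: q) ++ (n + 1) :: r := by simp
        rw [h3] at hr
        rcases append_eq_append_iff.1 hr with ⟨x, hx, hx'⟩ | ⟨x, hx, -⟩
        · cases x with
          | nil => exact ⟨[], by simpa using hx⟩
          | cons y x =>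
            simp only [cons_append, cons.injEq] at hx'
            exact absurd (by simp [hx'.2, hm2]) hmr
        · exact ⟨x, hx.symm⟩
      have h4 := (h1.trans key.sublist).filter (· ≠ n + 1)
      rw [filter_ne_eq_self (by simp; omega), filter_append, filter_cons_of_neg (by simp),
        filter_ne_eq_self hmp, filter_ne_eq_self hmq] at h4
      have := pairwise_iff_forall_sublist.1 hs h4
      omega

open List in
/-- Every avoiding word with largest label `n + 1` arises by inserting that label as in
`IsReversedCanonical.insert_pair`. All smaller labels occur behind the last `n + 1`, each of them
followed there by every smaller one, so a pair `x > y` in front of it gives `x y (n + 1) x y`. -/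
lemma IsReversedCanonical.exists_insert_pair {n : ℕ} {v : List ℕ}
    (hv : IsReversedCanonical (n + 1) v) (hav : AvoidsReversed v) :
    ∃ p q r : List ℕ, v = p ++ (n + 1) :: (q ++ (n + 1) :: r) ∧
      IsReversedCanonical n (p ++ (q ++ r)) ∧ AvoidsReversed (p ++ (q ++ r)) ∧
      (p ++ q).Pairwise (· < ·) := by
  have hc := hv.count_eq (n + 1)
  simp only [le_add_iff_nonneg_left, zero_le, le_refl, and_self, if_true] at hc
  obtain ⟨p, y, rfl, hmp⟩ := eq_append_cons_of_mem (count_pos_iff.1 (by omega : 0 < v.count (n + 1)))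
  rw [count_append, count_eq_zero_of_not_mem hmp, count_cons_self] at hc
  obtain ⟨q, r, rfl, hmq⟩ :=
    eq_append_cons_of_mem (count_pos_iff.1 (by omega : 0 < y.count (n + 1)))
  rw [count_append, count_eq_zero_of_not_mem hmq, count_cons_self] at hc
  have hmr : n + 1 ∉ r := count_eq_zero.1 (by omega)
  have hf := filter_ne_insert_pair hmp hmq hmr
  have hsub : p ++ (q ++ r) <+ p ++ (n + 1) :: (q ++ (n + 1) :: r) := hf ▸ filter_sublist
  have hle : ∀ a ∈ p ++ (q ++ r), 1 ≤ a ∧ a ≤ n := by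
    intro a ha
    have h := count_pos_iff.2 (hsub.subset ha)
    rw [hv.count_eq] at h
    have h' : a ≠ n + 1 := by
      rintro rfl
      simp [hmp, hmq, hmr] at ha
    split_ifs at h <;> omega
  refine ⟨p, q, r, rfl, ⟨?_, ?_⟩, fun a b c hab hbc h => hav a b c hab hbc (h.trans hsub), ?_⟩
  · intro a
    have h := hv.count_eq a
    by_cases ha : a = n + 1
    · subst ha
      rw [count_eq_zero_of_not_mem (by simp [hmp, hmq, hmr])]
      simp
    · have ha' : n + 1 ≠ a := Ne.symm ha
      simp only [count_append, count_cons_of_ne ha'] at h ⊢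
      rw [h]
      congr 1
      simp only [eq_iff_iff]
      omega
  · intro s t k hst hk
    rw [← hf] at hst
    obtain ⟨s', t', h1, -, h2⟩ := filter_eq_append_iff.1 hst
    obtain ⟨s'', t'', rfl, -, h3, rfl⟩ := filter_eq_cons_iff.1 h2
    have := hv.mem_of_succ (s' ++ s'') t'' k (by simp [h1]) hk
    refine mem_filter.2 ⟨this, ?_⟩
    have := hv.le_of_mem (a := k + 1) (by simp [h1])
    simp
    omega
  · rw [pairwise_iff_forall_sublist]
    intro x y hxy
    have hxn := hle x (by
      rw [← append_assoc]; exact mem_append_left _ (hxy.subset (by simp)))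
    have hyn := hle y (by
      rw [← append_assoc]; exact mem_append_left _ (hxy.subset (by simp)))
    have hxr : x ∈ r := by
      have hn := hv.mem_of_succ (p ++ (n + 1) :: q) r n (by simp) (by omega)
      exact hv.mem_of_le (s := p ++ (n + 1) :: (q ++ [n + 1])) (by simp) hn hxn.1 hxn.2
    by_contra! hyx
    rcases hyx.eq_or_lt with rfl | hyx
    · -- Two copies of `y` in `p ++ q` and one in `r` are too many.
      have h1 := (hxy.count_le y)
      have h2 := count_pos_iff.2 hxr
      have h3 := hsub.count_le y
      rw [hv.count_eq, if_pos (by omega)] at h3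
      simp only [count_append, count_cons_self, count_nil] at h1 h3
      omega
    · -- The pattern: `x y` from `p ++ q`, the last `n + 1`, and `x y` from `r`.
      have h1 := hv.pair_sublist (s := p ++ (n + 1) :: (q ++ [n + 1])) (t := r) (by simp) hxr
        hyn.1 hyx
      refine hav y x (n + 1) hyx (by omega) ?_
      have h2 : [x, y] ++ (n + 1) :: [x, y] <+ (p ++ (n + 1) :: q) ++ (n + 1) :: r :=
        (hxy.trans ((sublist_cons_self _ _).append_left p)).append (h1.cons_cons _)
      simpa using h2

/-! ### Enumeration of the avoiding words -/

/-- The length of the longest strictly increasing prefix. -/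
def increasingPrefixLength (w : List ℕ) : ℕ :=
  Nat.findGreatest (fun h => (w.take h).Pairwise (· < ·)) w.length

lemma le_increasingPrefixLength_iff {w : List ℕ} {h : ℕ} :
    h ≤ increasingPrefixLength w ↔ h ≤ w.length ∧ (w.take h).Pairwise (· < ·) := by
  constructor
  · intro hh
    refine ⟨hh.trans (Nat.findGreatest_le _), ?_⟩
    have : (w.take (increasingPrefixLength w)).Pairwise (· < ·) :=
      Nat.findGreatest_spec (P := fun h => (w.take h).Pairwise (· < ·)) (Nat.zero_le _) (by simp)
    exact this.sublist (List.take_sublist_take_left hh)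
  · exact fun ⟨h1, h2⟩ => Nat.le_findGreatest h1 h2

/-- Insert the letter `m` twice into `w`: after its first `j` and after its first `h` entries. -/
def insertPair (m : ℕ) (w : List ℕ) (h j : ℕ) : List ℕ :=
  w.take j ++ m :: ((w.take h).drop j ++ m :: w.drop h)

lemma take_append_drop_take_append_drop (w : List ℕ) {h j : ℕ} (hj : j ≤ h) :
    w.take j ++ ((w.take h).drop j ++ w.drop h) = w := by
  have h1 : w.take j = (w.take h).take j := by rw [List.take_take, min_eq_left hj]
  rw [h1, ← List.append_assoc, List.take_append_drop, List.take_append_drop]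

lemma insertPair_append (m : ℕ) (p q r : List ℕ) :
    insertPair m (p ++ (q ++ r)) (p.length + q.length) p.length = p ++ m :: (q ++ m :: r) := by
  simp [insertPair, List.take_append, List.drop_append]

lemma exists_insertPair_eq (m : ℕ) (w : List ℕ) {h j : ℕ} (hj : j ≤ h) (hh : h ≤ w.length) :
    ∃ p q r : List ℕ, w = p ++ (q ++ r) ∧ p.length = j ∧ p.length + q.length = h ∧
      p ++ q = w.take h ∧ insertPair m w h j = p ++ m :: (q ++ m :: r) := by
  refine ⟨w.take j, (w.take h).drop j, w.drop h,
    (take_append_drop_take_append_drop w hj).symm, ?_, ?_, ?_, rfl⟩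
  · simp; omega
  · simp; omega
  · rw [show w.take j = (w.take h).take j by rw [List.take_take, min_eq_left hj],
      List.take_append_drop]

lemma List.append_cons_inj_of_notMem_left {m : ℕ} {p p' y y' : List ℕ} (hp : m ∉ p)
    (hp' : m ∉ p') (h : p ++ m :: y = p' ++ m :: y') : p = p' ∧ y = y' := by
  have h1 := congrArg (List.idxOf m) h
  rw [List.idxOf_append_of_notMem hp, List.idxOf_append_of_notMem hp'] at h1
  simp only [List.idxOf_cons_self, add_zero] at h1
  obtain ⟨rfl, h2⟩ := List.append_inj h h1
  exact ⟨rfl, (List.cons.inj h2).2⟩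

lemma insertPair_inj {m : ℕ} {w w' : List ℕ} {h j h' j' : ℕ} (hw : m ∉ w) (hw' : m ∉ w')
    (hj : j ≤ h) (hh : h ≤ w.length) (hj' : j' ≤ h') (hh' : h' ≤ w'.length)
    (heq : insertPair m w h j = insertPair m w' h' j') : w = w' ∧ h = h' ∧ j = j' := by
  obtain ⟨p, q, r, rfl, rfl, rfl, -, he⟩ := exists_insertPair_eq m w hj hh
  obtain ⟨p', q', r', rfl, rfl, rfl, -, he'⟩ := exists_insertPair_eq m w' hj' hh'
  rw [he, he'] at heq
  simp only [List.mem_append, not_or] at hw hw'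
  obtain ⟨rfl, heq'⟩ := List.append_cons_inj_of_notMem_left hw.1 hw'.1 heq
  obtain ⟨rfl, rfl⟩ := List.append_cons_inj_of_notMem_left hw.2.1 hw'.2.1 heq'
  simp

/-- The prefix stops increasing right after the first copy of the new largest letter. -/
lemma increasingPrefixLength_insertPair {m : ℕ} {w : List ℕ} {h j : ℕ} (hm : ∀ a ∈ w, a < m)
    (hj : j ≤ h) (hh : h ≤ increasingPrefixLength w) :
    increasingPrefixLength (insertPair m w h j) = j + 1 := by
  obtain ⟨hlen, hs⟩ := le_increasingPrefixLength_iff.1 hh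
  obtain ⟨p, q, r, rfl, rfl, rfl, hpq, he⟩ := exists_insertPair_eq m w hj hlen
  rw [← hpq] at hs
  rw [he]
  refine le_antisymm ?_ ?_
  · by_contra! hlt
    have h2 := (le_increasingPrefixLength_iff.1 (Nat.succ_le_of_lt hlt)).2
    obtain ⟨x, t, hx⟩ : ∃ x t, q ++ m :: r = x :: t := by
      cases q <;> simp
    have hxm : x ≤ m := by
      have : x ∈ q ++ m :: r := by simp [hx]
      simp only [List.mem_append, List.mem_cons] at this
      rcases this with h | h | h
      · exact (hm x (by simp [h])).le
      · exact h.le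
      · exact (hm x (by simp [h])).le
    rw [hx, List.take_append] at h2
    rw [show (p.length + 1).succ - p.length = 2 by omega] at h2
    have h3 := (List.pairwise_append.1 h2).2.1
    simp at h3
    omega
  · refine le_increasingPrefixLength_iff.2 ⟨by simp, ?_⟩
    rw [List.take_append]
    simp only [List.take_of_length_le (Nat.le_succ _), Nat.add_sub_cancel_left, List.take_succ_cons,
      List.take_zero]
    refine List.pairwise_append.2 ⟨(List.pairwise_append.1 hs).1, by simp, ?_⟩
    intro a ha b hb
    rw [List.mem_singleton.1 hb]
    exact hm a (by simp [ha])

/-- The triples `(w, h, j)` that say where the next largest letter goes. -/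
def insertionSites (S : Finset (List ℕ)) : Finset ((_ : List ℕ) × (_ : ℕ) × ℕ) :=
  S.sigma fun w => (Finset.range (increasingPrefixLength w + 1)).sigma fun h =>
    Finset.range (h + 1)

lemma mem_insertionSites {S : Finset (List ℕ)} {x : (_ : List ℕ) × (_ : ℕ) × ℕ} :
    x ∈ insertionSites S ↔ x.1 ∈ S ∧ x.2.1 ≤ increasingPrefixLength x.1 ∧ x.2.2 ≤ x.2.1 := by
  simp [insertionSites]

/-- The reversed canonical words with labels `1, …, n` that avoid the pattern, generated by
inserting the labels in increasing order. -/
def avoidingWords : ℕ → Finset (List ℕ)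
  | 0 => {[]}
  | n + 1 => (insertionSites (avoidingWords n)).image fun x => insertPair (n + 1) x.1 x.2.1 x.2.2

lemma mem_avoidingWords {n : ℕ} {w : List ℕ} :
    w ∈ avoidingWords n ↔ IsReversedCanonical n w ∧ AvoidsReversed w := by
  induction n generalizing w with
  | zero =>
    rw [avoidingWords, Finset.mem_singleton]
    constructor
    · rintro rfl
      refine ⟨⟨fun a => ?_, by simp⟩, fun a b c _ _ h => by simp at h⟩
      simp
      omega
    · rintro ⟨h, -⟩
      refine List.eq_nil_iff_forall_not_mem.2 fun a ha => ?_
      have h1 := List.count_pos_iff.2 ha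
      rw [h.count_eq, if_neg (by omega)] at h1
      omega
  | succ n ih =>
    rw [avoidingWords, Finset.mem_image]
    constructor
    · rintro ⟨⟨w, h, j⟩, hx, rfl⟩
      obtain ⟨hw, hh, hj⟩ := mem_insertionSites.1 hx
      obtain ⟨hcan, hav⟩ := ih.1 hw
      obtain ⟨hlen, hs⟩ := le_increasingPrefixLength_iff.1 hh
      obtain ⟨p, q, r, rfl, rfl, hq, hpq, he⟩ := exists_insertPair_eq (n + 1) w hj hlen
      simp only at hs hcan hav hpq
      rw [← hpq] at hs
      rw [he]
      exact hcan.insert_pair hav hs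
    · rintro ⟨hcan, hav⟩
      obtain ⟨p, q, r, rfl, hcan', hav', hs⟩ := hcan.exists_insert_pair hav
      refine ⟨⟨p ++ (q ++ r), p.length + q.length, p.length⟩, mem_insertionSites.2
        ⟨ih.2 ⟨hcan', hav'⟩, le_increasingPrefixLength_iff.2 ⟨by simp, ?_⟩,
          Nat.le_add_right _ _⟩, insertPair_append _ _ _ _⟩
      simp only
      rwa [← List.append_assoc, ← List.length_append, List.take_left]

lemma sum_avoidingWords_succ (n : ℕ) (f : ℕ → ℕ) :
    ∑ w ∈ avoidingWords (n + 1), f (increasingPrefixLength w) =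
      ∑ w ∈ avoidingWords n, ∑ h ∈ Finset.range (increasingPrefixLength w + 1),
        ∑ j ∈ Finset.range (h + 1), f (j + 1) := by
  rw [avoidingWords, Finset.sum_image, insertionSites, Finset.sum_sigma]
  · refine Finset.sum_congr rfl fun w hw => ?_
    rw [Finset.sum_sigma]
    refine Finset.sum_congr rfl fun h hh => Finset.sum_congr rfl fun j hj => ?_
    rw [increasingPrefixLength_insertPair]
    · exact fun a ha => Nat.lt_succ_of_le ((mem_avoidingWords.1 hw).1.le_of_mem ha)
    · simpa [Nat.lt_succ_iff] using hj
    · simpa [Nat.lt_succ_iff] using hh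
  · rintro ⟨w, h, j⟩ hx ⟨w', h', j'⟩ hx' heq
    obtain ⟨hw, hh, hj⟩ := mem_insertionSites.1 hx
    obtain ⟨hw', hh', hj'⟩ := mem_insertionSites.1 hx'
    obtain ⟨rfl, rfl, rfl⟩ := insertPair_inj (mem_avoidingWords.1 hw).1.succ_notMem
      (mem_avoidingWords.1 hw').1.succ_notMem hj (le_increasingPrefixLength_iff.1 hh).1
      hj' (le_increasingPrefixLength_iff.1 hh').1 heq
    rfl

/-- The words whose longest increasing prefix has length `s` are counted by the coefficient of
`x ^ n` in `x ^ s T ^ (2 s)`. -/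
lemma sum_avoidingWords (n : ℕ) (f : ℕ → ℕ) :
    ∑ w ∈ avoidingWords n, f (increasingPrefixLength w) =
      ∑ s ∈ Finset.range (n + 1), ternaryCoeff (n - s) (2 * s) * f s := by
  induction n generalizing f with
  | zero => simp [avoidingWords, ternaryCoeff, increasingPrefixLength]
  | succ n ih =>
    rw [sum_avoidingWords_succ,
      ih fun s => ∑ h ∈ Finset.range (s + 1), ∑ j ∈ Finset.range (h + 1), f (j + 1)]
    have h1 := sum_ternaryCoeff_mul_sum n 0 fun h => ∑ j ∈ Finset.range (h + 1), f (j + 1)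
    have h2 := sum_ternaryCoeff_mul_sum n 1 fun j => f (j + 1)
    simp only [add_zero] at h1
    rw [h1, h2, Finset.sum_range_succ' _ (n + 1)]
    simp [ternaryCoeff, mul_add]

lemma card_avoidingWords (n : ℕ) : (avoidingWords n).card = ternaryCoeff n 1 := by
  have h := sum_avoidingWords n fun _ => 1
  have h' := sum_ternaryCoeff n 0
  simp only [zero_add] at h'
  rw [Finset.card_eq_sum_ones, h, ← h']
  simp

/-! ### Reversed words as sequences -/

lemma count_ofFn {N : ℕ} (π : Fin N → ℕ) (a : ℕ) :
    (List.ofFn π).count a = (Finset.univ.filter fun x => π x = a).card := by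
  rw [← Multiset.coe_count, ← Fin.univ_val_map, Multiset.count_map, Finset.card_def,
    Finset.filter_val]
  simp only [eq_comm]

lemma isReversedCanonical_reverse_ofFn {n N : ℕ} (π : Fin N → ℕ) :
    IsReversedCanonical n (List.ofFn π).reverse ↔
      (∀ a, (Finset.univ.filter fun x => π x = a).card = if 1 ≤ a ∧ a ≤ n then 2 else 0) ∧
      ∀ x k, 1 ≤ k → π x = k + 1 → ∃ y < x, π y = k := by
  constructor
  · rintro ⟨hc, hp⟩
    refine ⟨fun a => by rw [← count_ofFn, ← List.count_reverse, hc], fun x k hk hx => ?_⟩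
    have h : (List.ofFn π) = (List.ofFn π).take x ++ (k + 1) :: (List.ofFn π).drop (x + 1) := by
      have h1 : (List.ofFn π)[(x : ℕ)]'(by simp) = k + 1 := by simp [hx]
      rw [← h1, ← List.drop_eq_getElem_cons, List.take_append_drop]
    have h2 := hp ((List.ofFn π).drop (x + 1)).reverse ((List.ofFn π).take x).reverse k
      (by conv_lhs => rw [h]
          simp) hk
    rw [List.mem_reverse, List.mem_take_iff_getElem] at h2
    obtain ⟨i, hi, hik⟩ := h2
    simp only [List.length_ofFn, lt_min_iff] at hi
    exact ⟨⟨i, hi.2⟩, hi.1, by simpa using hik⟩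
  · rintro ⟨hc, hp⟩
    refine ⟨fun a => by rw [List.count_reverse, count_ofFn, hc], fun s t k hst hk => ?_⟩
    have hst' : List.ofFn π = t.reverse ++ (k + 1) :: s.reverse := by
      rw [← List.reverse_inj, hst]
      simp
    have hlen : N = t.length + (s.length + 1) := by
      have := congrArg List.length hst'
      simpa using this
    have hget : ∀ (i : ℕ) (hi : i < N), π ⟨i, hi⟩ =
        (t.reverse ++ (k + 1) :: s.reverse)[i]'(by simp; omega) := by
      intro i hi
      simp [← hst']
    obtain ⟨y, hy, hyk⟩ := hp ⟨t.length, by omega⟩ k hk (by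
      rw [hget, List.getElem_append_right (by simp)]
      simp)
    have hy' : (y : ℕ) < t.length := hy
    rw [← hyk, hget y y.2, List.getElem_append_left (by simpa using hy'), ← List.mem_reverse]
    exact List.getElem_mem _

lemma IsReversedCanonical.length_eq {n : ℕ} {w : List ℕ} (hw : IsReversedCanonical n w) :
    w.length = 2 * n := by
  have h := Multiset.sum_count_eq_card (s := Finset.Icc 1 n) (m := (w : Multiset ℕ))
    (fun a ha => by
      have h := List.count_pos_iff.2 (Multiset.mem_coe.1 ha)
      rw [hw.count_eq] at h
      split_ifs at h with h'
      · exact Finset.mem_Icc.2 h'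
      · omega)
  rw [Multiset.coe_card, Finset.sum_congr rfl fun a ha => by
    rw [Multiset.coe_count, hw.count_eq, if_pos (Finset.mem_Icc.1 ha)]] at h
  rw [← h]
  simp [mul_comm]

lemma avoidsReversed_reverse_ofFn {N : ℕ} (π : Fin N → ℕ) :
    AvoidsReversed (List.ofFn π).reverse ↔
      ¬ ∃ f : Fin 5 → Fin N, StrictMono f ∧
        OrderIsomorphic (fun i => π (f i)) ![1, 2, 3, 1, 2] := by
  constructor
  · rintro h ⟨f, hf, hiso⟩
    have e0 : π (f 3) = π (f 0) := by
      have h1 := hiso 0 3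
      have h2 := hiso 3 0
      simp at h1 h2
      omega
    have e1 : π (f 4) = π (f 1) := by
      have h1 := hiso 1 4
      have h2 := hiso 4 1
      simp at h1 h2
      omega
    refine h (π (f 0)) (π (f 1)) (π (f 2)) ((hiso 0 1).2 (by simp)) ((hiso 1 2).2 (by simp)) ?_
    rw [← List.reverse_reverse [_, _, _, _, _], List.reverse_sublist,
      List.sublist_iff_exists_fin_orderEmbedding_get_eq]
    refine ⟨(OrderEmbedding.ofStrictMono f hf).trans
      (Fin.castOrderIso (by simp)).toOrderEmbedding, fun ix => ?_⟩
    simp only [List.get_eq_getElem, List.getElem_ofFn]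
    change _ = π (f ix)
    fin_cases ix
    exacts [rfl, rfl, rfl, e0.symm, e1.symm]
  · intro h a b c hab hbc hsub
    rw [← List.reverse_reverse [_, _, _, _, _], List.reverse_sublist,
      List.sublist_iff_exists_fin_orderEmbedding_get_eq] at hsub
    obtain ⟨f, hf⟩ := hsub
    refine h ⟨fun i => Fin.cast (by simp) (f i), fun i j hij => ?_, fun i j => ?_⟩
    · exact f.strictMono hij
    · have hπ : ∀ i : Fin 5, π (Fin.cast (by simp) (f i)) = ![a, b, c, a, b] i := by
        intro i
        have := hf i
        simp only [List.get_eq_getElem, List.getElem_ofFn] at this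
        change _ = π (Fin.cast (List.length_ofFn) (f i)) at this
        rw [← this]
        fin_cases i <;> rfl
      simp only [hπ]
      fin_cases i <;> fin_cases j <;> simp <;> omega

/-! ### Canonical sequential forms -/

lemma card_filter_le_lt_card_filter_le_iff {α β : Type*} [LinearOrder β] {S : Finset α} {f : α → β}
    {A B : α} (hB : B ∈ S) :
    (S.filter fun C => f C ≤ f A).card < (S.filter fun C => f C ≤ f B).card ↔ f A < f B := by
  constructor
  · intro h
    by_contra! hBA
    refine absurd h (not_lt.2 (Finset.card_le_card fun C hC => ?_))
    rw [Finset.mem_filter] at hC ⊢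
    exact ⟨hC.1, hC.2.trans hBA⟩
  · intro h
    refine Finset.card_lt_card ⟨fun C hC => ?_, fun hsub => ?_⟩
    · rw [Finset.mem_filter] at hC ⊢
      exact ⟨hC.1, hC.2.trans h.le⟩
    · exact absurd (Finset.mem_filter.1 (hsub (Finset.mem_filter.2 ⟨hB, le_rfl⟩))).2 (not_le.2 h)

namespace Matching

variable {n : ℕ} (M : Matching n)

/-- The label of a block: its position when the blocks are listed by increasing minima. -/
def blockLabel (B : Finset ℕ) : ℕ :=
  (M.1.parts.filter fun C => C.min ≤ B.min).card

lemma canonicalForm_eq (x : Fin (2 * n)) :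
    M.canonicalForm x = M.blockLabel (M.1.part (x.1 + 1)) := rfl

lemma succ_mem_Icc (x : Fin (2 * n)) : x.1 + 1 ∈ Finset.Icc 1 (2 * n) := by
  have := x.2
  rw [Finset.mem_Icc]
  omega

lemma blockLabel_lt_iff {A B : Finset ℕ} (hB : B ∈ M.1.parts) :
    M.blockLabel A < M.blockLabel B ↔ A.min < B.min :=
  card_filter_le_lt_card_filter_le_iff (f := Finset.min) hB

lemma blockLabel_injOn : Set.InjOn M.blockLabel M.1.parts := by
  intro A hA B hB hAB
  have h1 := (M.blockLabel_lt_iff (A := A) hB).not.1 hAB.not_lt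
  have h2 := (M.blockLabel_lt_iff (A := B) hA).not.1 hAB.not_gt
  have h : A.min = B.min := le_antisymm (not_lt.1 h2) (not_lt.1 h1)
  obtain ⟨a, ha⟩ := Finset.min_of_nonempty (M.1.nonempty_of_mem_parts hA)
  exact M.1.eq_of_mem_parts hA hB (Finset.mem_of_min ha) (Finset.mem_of_min (h ▸ ha))

lemma card_parts : M.1.parts.card = n := by
  have h := M.1.sum_card_parts
  rw [Finset.sum_congr rfl M.2] at h
  simp at h
  omega

lemma image_blockLabel : M.1.parts.image M.blockLabel = Finset.Icc 1 n := by
  refine Finset.eq_of_subset_of_card_le ?_ ?_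
  · intro k hk
    obtain ⟨B, hB, rfl⟩ := Finset.mem_image.1 hk
    refine Finset.mem_Icc.2 ⟨Finset.card_pos.2 ⟨B, Finset.mem_filter.2 ⟨hB, le_rfl⟩⟩, ?_⟩
    exact (Finset.card_filter_le _ _).trans M.card_parts.le
  · rw [Finset.card_image_of_injOn M.blockLabel_injOn, M.card_parts]
    simp

lemma canonicalForm_eq_blockLabel_iff {B : Finset ℕ} (hB : B ∈ M.1.parts) (x : Fin (2 * n)) :
    M.canonicalForm x = M.blockLabel B ↔ x.1 + 1 ∈ B := by
  rw [canonicalForm_eq, M.blockLabel_injOn.eq_iff (M.1.part_mem.2 (succ_mem_Icc x)) hB,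
    M.1.part_eq_iff_mem hB]

lemma card_canonicalForm_eq (a : ℕ) :
    (Finset.univ.filter fun x => M.canonicalForm x = a).card = if 1 ≤ a ∧ a ≤ n then 2 else 0 := by
  simp only [← Finset.mem_Icc, ← M.image_blockLabel]
  split_ifs with h
  · obtain ⟨B, hB, rfl⟩ := Finset.mem_image.1 h
    simp_rw [M.canonicalForm_eq_blockLabel_iff hB]
    refine Eq.trans ?_ (M.2 B hB)
    refine Finset.card_bij (fun x _ => x.1 + 1) (fun x hx => (Finset.mem_filter.1 hx).2)
      (fun x _ y _ hxy => Fin.ext (by omega)) fun y hy => ?_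
    have := Finset.mem_Icc.1 (M.1.subset hB hy)
    exact ⟨⟨y - 1, by omega⟩, by simp [Nat.sub_add_cancel this.1, hy], by simp [this.1]⟩
  · rw [Finset.card_eq_zero, Finset.filter_eq_empty_iff]
    rintro x - rfl
    exact h (Finset.mem_image_of_mem _ (M.1.part_mem.2 (succ_mem_Icc x)))

lemma exists_lt_canonicalForm_eq {x : Fin (2 * n)} {k : ℕ} (hk : 1 ≤ k)
    (hx : M.canonicalForm x = k + 1) : ∃ y < x, M.canonicalForm y = k := by
  have hxP := M.1.part_mem.2 (succ_mem_Icc x)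
  have hkn : k + 1 ∈ Finset.Icc 1 n := by
    rw [← M.image_blockLabel, ← hx]
    exact Finset.mem_image_of_mem _ hxP
  have hk' : k ∈ M.1.parts.image M.blockLabel := by
    rw [M.image_blockLabel]
    simp at hkn ⊢
    omega
  obtain ⟨B, hB, rfl⟩ := Finset.mem_image.1 hk'
  have hlt : B.min < (M.1.part (x.1 + 1)).min :=
    (M.blockLabel_lt_iff hxP).1 (by rw [← canonicalForm_eq, hx]; omega)
  obtain ⟨b, hb⟩ := Finset.min_of_nonempty (M.1.nonempty_of_mem_parts hB)
  have hbB := Finset.mem_of_min hb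
  have hbI := Finset.mem_Icc.1 (M.1.subset hB hbB)
  have hbx : b < x.1 + 1 := by
    have h1 : (M.1.part (x.1 + 1)).min ≤ ((x.1 + 1 : ℕ) : WithTop ℕ) :=
      Finset.min_le (M.1.mem_part_self.2 (succ_mem_Icc x))
    rw [hb] at hlt
    exact WithTop.coe_lt_coe.1 (hlt.trans_le h1)
  refine ⟨⟨b - 1, by omega⟩, ?_, ?_⟩
  · rw [Fin.lt_def]
    simp only
    omega
  · rw [M.canonicalForm_eq_blockLabel_iff hB]
    simpa [Nat.sub_add_cancel hbI.1] using hbB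

/-- The reversed canonical sequential form as a list. -/
def reversedForm : List ℕ := (List.ofFn M.canonicalForm).reverse

lemma isReversedCanonical_reversedForm : IsReversedCanonical n M.reversedForm :=
  (isReversedCanonical_reverse_ofFn _).2
    ⟨M.card_canonicalForm_eq, fun _ _ => M.exists_lt_canonicalForm_eq⟩

lemma avoidsReversed_reversedForm : AvoidsReversed M.reversedForm ↔ M.Avoids ![1, 2, 3, 1, 2] :=
  avoidsReversed_reverse_ofFn _

lemma canonicalForm_injective : Function.Injective (canonicalForm (n := n)) := by
  intro M N h
  have key : ∀ M N : Matching n, M.canonicalForm = N.canonicalForm → M.1.parts ⊆ N.1.parts := by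
    intro M N h B hB
    obtain ⟨a, ha⟩ := M.1.nonempty_of_mem_parts hB
    have haI := Finset.mem_Icc.1 (M.1.subset hB ha)
    obtain ⟨C, hC, haC⟩ := N.1.exists_mem (M.1.subset hB ha)
    have hBC : B ⊆ C := by
      intro b hb
      have hbI := Finset.mem_Icc.1 (M.1.subset hB hb)
      have h1 := (M.canonicalForm_eq_blockLabel_iff hB ⟨a - 1, by omega⟩).2
        (by simpa [Nat.sub_add_cancel haI.1] using ha)
      have h2 := (M.canonicalForm_eq_blockLabel_iff hB ⟨b - 1, by omega⟩).2
        (by simpa [Nat.sub_add_cancel hbI.1] using hb)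
      have h3 := (N.canonicalForm_eq_blockLabel_iff hC ⟨a - 1, by omega⟩).2
        (by simpa [Nat.sub_add_cancel haI.1] using haC)
      rw [h] at h1 h2
      have h4 := (N.canonicalForm_eq_blockLabel_iff hC ⟨b - 1, by omega⟩).1 (by
        rw [h2, ← h1, h3])
      simpa [Nat.sub_add_cancel hbI.1] using h4
    rwa [Finset.eq_of_subset_of_card_le hBC (by rw [M.2 B hB, N.2 C hC])]
  exact Subtype.ext (Finpartition.ext ((key M N h).antisymm (key N M h.symm)))

/-- Every sequence with the two properties of a canonical sequential form is the canonical
sequential form of the matching whose blocks are its fibres. -/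
lemma exists_canonicalForm_eq (π : Fin (2 * n) → ℕ)
    (hc : ∀ a, (Finset.univ.filter fun x => π x = a).card = if 1 ≤ a ∧ a ≤ n then 2 else 0)
    (hp : ∀ x k, 1 ≤ k → π x = k + 1 → ∃ y < x, π y = k) :
    ∃ M : Matching n, M.canonicalForm = π := by
  -- `F k` is the block labelled `k`.
  let F : ℕ → Finset ℕ := fun k => (Finset.univ.filter fun x => π x = k).image fun x => x.1 + 1
  have hF : ∀ k (x : Fin (2 * n)), x.1 + 1 ∈ F k ↔ π x = k := by
    intro k x
    simp only [F, Finset.mem_image, Finset.mem_filter, Finset.mem_univ, true_and]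
    constructor
    · rintro ⟨y, rfl, hy⟩
      rw [Fin.ext (show y.1 = x.1 by omega)]
    · exact fun h => ⟨x, h, rfl⟩
  have hFcard : ∀ k, (F k).card = if 1 ≤ k ∧ k ≤ n then 2 else 0 := by
    intro k
    rw [← hc k]
    exact Finset.card_image_of_injective _ fun x y hxy => Fin.ext (by simpa using hxy)
  have hπ : ∀ x, 1 ≤ π x ∧ π x ≤ n := by
    intro x
    by_contra h
    have h1 := hFcard (π x)
    rw [if_neg h, Finset.card_eq_zero] at h1
    have h2 := (hF (π x) x).2 rfl
    simp [h1] at h2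
  have hFex : ∀ k, ∀ y ∈ F k, ∃ x : Fin (2 * n), x.1 + 1 = y ∧ π x = k := by
    intro k y hy
    obtain ⟨x, hx, rfl⟩ := Finset.mem_image.1 hy
    exact ⟨x, rfl, (Finset.mem_filter.1 hx).2⟩
  let P : Finpartition (Finset.Icc 1 (2 * n)) :=
    Finpartition.ofExistsUnique ((Finset.Icc 1 n).image F)
      (by
        intro B hB y hy
        obtain ⟨k, -, rfl⟩ := Finset.mem_image.1 hB
        obtain ⟨x, rfl, -⟩ := hFex k y hy
        exact succ_mem_Icc x)
      (by
        intro y hy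
        rw [Finset.mem_Icc] at hy
        obtain ⟨x, rfl⟩ : ∃ x : Fin (2 * n), y = x.1 + 1 := ⟨⟨y - 1, by omega⟩, by simp; omega⟩
        refine ⟨F (π x), ⟨Finset.mem_image_of_mem _ (Finset.mem_Icc.2 (hπ x)),
          (hF _ _).2 rfl⟩, ?_⟩
        rintro B ⟨hB, hxB⟩
        obtain ⟨k, -, rfl⟩ := Finset.mem_image.1 hB
        rw [(hF _ _).1 hxB])
      (by
        intro h
        obtain ⟨k, hk, hk'⟩ := Finset.mem_image.1 h
        have := hFcard k
        rw [if_pos (Finset.mem_Icc.1 hk), hk'] at this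
        simp at this)
  have hPparts : P.parts = (Finset.Icc 1 n).image F := rfl
  have hPcard : ∀ B ∈ P.parts, B.card = 2 := by
    intro B hB
    obtain ⟨k, hk, rfl⟩ := Finset.mem_image.1 (hPparts ▸ hB)
    rw [hFcard, if_pos (Finset.mem_Icc.1 hk)]
  -- Iterating `hp`, all smaller labels occur before a given entry, so the minima of the blocks
  -- increase with their labels.
  have hlow : ∀ k x, 1 ≤ k → k < π x → ∃ y < x, π y = k := by
    intro k x hk
    generalize hm : π x = m
    intro hkm
    induction m generalizing x with
    | zero => omega
    | succ m ih =>
      obtain ⟨y, hy, hym⟩ := hp x m (by omega) hm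
      rcases (Nat.lt_succ_iff.1 hkm).eq_or_lt with rfl | h
      · exact ⟨y, hy, hym⟩
      · obtain ⟨z, hz, hzk⟩ := ih y hym h
        exact ⟨z, hz.trans hy, hzk⟩
  have hmin : ∀ k k', k ∈ Finset.Icc 1 n → k' ∈ Finset.Icc 1 n → k < k' →
      (F k).min < (F k').min := by
    intro k k' hk hk' hkk'
    have hne : (F k').Nonempty := by
      rw [← Finset.card_pos, hFcard, if_pos (Finset.mem_Icc.1 hk')]
      norm_num
    obtain ⟨b, hb⟩ := Finset.min_of_nonempty hne
    obtain ⟨x, rfl, hx⟩ := hFex k' b (Finset.mem_of_min hb)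
    obtain ⟨y, hy, hyk⟩ := hlow k x (Finset.mem_Icc.1 hk).1 (by omega)
    rw [hb]
    refine (Finset.min_le ((hF k y).2 hyk)).trans_lt (WithTop.coe_lt_coe.2 ?_)
    exact Nat.succ_lt_succ hy
  have hminle : ∀ k ∈ Finset.Icc 1 n, ∀ k' ∈ Finset.Icc 1 n,
      ((F k).min ≤ (F k').min ↔ k ≤ k') := by
    intro k hk k' hk'
    constructor
    · intro h
      by_contra! hlt
      exact absurd h (not_le.2 (hmin k' k hk' hk hlt))
    · intro h
      rcases h.eq_or_lt with rfl | h
      · exact le_rfl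
      · exact (hmin k k' hk hk' h).le
  have hFinj : Set.InjOn F (Finset.Icc 1 n) := by
    intro k hk k' hk' h
    exact le_antisymm ((hminle k hk k' hk').1 (h ▸ le_rfl)) ((hminle k' hk' k hk).1 (h ▸ le_rfl))
  refine ⟨⟨P, hPcard⟩, funext fun x => ?_⟩
  have hk := Finset.mem_Icc.2 (hπ x)
  have hpart : P.part (x.1 + 1) = F (π x) :=
    P.part_eq_of_mem (hPparts ▸ Finset.mem_image_of_mem _ hk) ((hF _ _).2 rfl)
  unfold canonicalForm
  simp only
  rw [hpart, hPparts, Finset.filter_image, Finset.card_image_of_injOn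
    (hFinj.mono fun k hk => (Finset.mem_filter.1 hk).1),
    Finset.filter_congr fun k hk' => hminle k hk' _ hk]
  have : (Finset.Icc 1 n).filter (fun k => k ≤ π x) = Finset.Icc 1 (π x) := by
    ext k
    have := (hπ x).2
    simp
    omega
  rw [this]
  simp

lemma card_avoids : Nat.card {M : Matching n // M.Avoids ![1, 2, 3, 1, 2]} =
    (avoidingWords n).card := by
  rw [← Nat.card_eq_finsetCard]
  refine Nat.card_congr (Equiv.ofBijective (fun M => ⟨M.1.reversedForm, mem_avoidingWords.2
    ⟨M.1.isReversedCanonical_reversedForm, M.1.avoidsReversed_reversedForm.2 M.2⟩⟩) ⟨?_, ?_⟩)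
  · intro M N h
    have h1 : M.1.reversedForm = N.1.reversedForm := congrArg Subtype.val h
    exact Subtype.ext (canonicalForm_injective (List.ofFn_injective (List.reverse_injective h1)))
  · rintro ⟨w, hw⟩
    obtain ⟨hcan, hav⟩ := mem_avoidingWords.1 hw
    have hlen : w.reverse.length = 2 * n := by rw [List.length_reverse, hcan.length_eq]
    obtain ⟨π, rfl⟩ : ∃ π : Fin (2 * n) → ℕ, w = (List.ofFn π).reverse := by
      refine ⟨fun i => w.reverse.get (i.cast hlen.symm), ?_⟩
      rw [← List.reverse_inj, List.reverse_reverse]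
      refine List.ext_getElem (by simpa using hlen) fun i h1 h2 => by simp
    obtain ⟨hc, hp⟩ := (isReversedCanonical_reverse_ofFn π).1 hcan
    obtain ⟨M, rfl⟩ := exists_canonicalForm_eq π hc hp
    exact ⟨⟨M, M.avoidsReversed_reversedForm.1 hav⟩, rfl⟩

end Matching

theorem mainTheorem1 (n : ℕ) :
    (Nat.card {M : Matching n // M.Avoids ![1, 2, 3, 1, 2]} : ℚ) = kCatalan n 3 := by
  rw [Matching.card_avoids, card_avoidingWords, kCatalan, ← two_mul_add_one_mul_ternaryCoeff_one]
  push_cast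
  have : (2 * n + 1 : ℚ) ≠ 0 := by positivity
  rw [show ((3 : ℚ) - 1) * n + 1 = 2 * n + 1 by ring]
  field_simp
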